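/- Let $H$ be a compact topological group, let $\mathcal H$ be a complex Hilbert space carrying a strongly continuous unitary representation $\rho$ of $H$, and put $I=[0,1]$. Let $\{D_u\}_{u\in I}$ be a family of (in general unbounded) self-adjoint operators on $\mathcal H$ such that * each spectrum $\operatorname{spec} D_u$ is discrete, i.e. every point of it is isolated in it; * the family is continuous in the norm-resolvent sense: $u\mapsto (D_u-i)^{-1}$ is continuous for the operator norm; * each $D_u$ is compatible with $H$: every $\rho(h)$ maps $\operatorname{dom}D_u$ into itself and $D_u\rho(h)x=\rho(h)D_ux$ for $x\in\operatorname{dom}D_u$. (This includes every norm-continuous family of $H$-equivariant self-adjoint elliptic operators $D_u:H^m\to L^2$ of fixed order $m>0$ on a Hermitian vector bundle over a closed manifold, with $\mathcal H$ the space of $L^2$ sections.) For $\lambda\in\mathbb R$ let $\Gamma_{u,\lambda}=\{x\in\operatorname{dom}D_u : D_ux=\lambda x\}$, and for an open set $U\subset\mathbb R$ let $\Gamma_{u,U}=\bigoplus_{\lambda\in U\cap\operatorname{spec}D_u}\Gamma_{u,\lambda}$; these are $H$-invariant subspaces. **Lemma 2.2.** Let $u_0\in I$ and let $\lambda\in\operatorname{spec}D_{u_0}$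 with $\dim\Gamma_{u_0,\lambda}=k<\infty$. Then there are an open set $U\subset\mathbb R$ containing $\lambda$ and an $\epsilon>0$ such that for every $u\in I$ with $|u-u_0|<\epsilon$, $$\dim\Gamma_{u,U}=k,$$ and $\Gamma_{u,U}$ and $\Gamma_{u_0,\lambda}$ are isomorphic representations of $H$ (so they define the same element of the representation ring $R(H)$). -/

import Mathlib

open Topology

namespace EquivariantSpectrum

section Operators

variable {E : Type*} [NormedAddCommGroup E] [InnerProductSpace ℂ E]

/-- The bounded operator `R` is the resolvent `(D - z)⁻¹` of the (in general unbounded) operator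
`D`: it maps into the domain of `D` and is a two-sided inverse of `D - z : D.domain → E`. -/
structure IsResolventAt (D : E →ₗ.[ℂ] E) (z : ℂ) (R : E →L[ℂ] E) : Prop where
  mem_domain : ∀ y : E, R y ∈ D.domain
  right_inv : ∀ y : E, D ⟨R y, mem_domain y⟩ - z • R y = y
  left_inv : ∀ x : D.domain, R (D x - z • (x : E)) = x

/-- The spectrum of an unbounded operator: the complement of the set of those `z` for which
`D - z` has a bounded everywhere defined inverse. -/
def spec (D : E →ₗ.[ℂ] E) : Set ℂ :=
  {z | ¬ ∃ R : E →L[ℂ] E, IsResolventAt D z R}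

/-- The spectrum is discrete: each of its points is isolated in it. -/
def HasDiscreteSpectrum (D : E →ₗ.[ℂ] E) : Prop :=
  DiscreteTopology (spec D)

/-- The eigenspace `Γ_l = {x ∈ dom D | D x = l x}` for a real number `l`. -/
def eigenspace (D : E →ₗ.[ℂ] E) (l : ℝ) : Submodule ℂ E where
  carrier := {x | ∃ hx : x ∈ D.domain, D ⟨x, hx⟩ = (l : ℂ) • x}
  zero_mem' := ⟨D.domain.zero_mem, by
    rw [smul_zero]; exact D.map_zero⟩
  add_mem' := by
    rintro x y ⟨hx, ex⟩ ⟨hy, ey⟩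
    refine ⟨D.domain.add_mem hx hy, ?_⟩
    rw [smul_add, ← ex, ← ey, ← D.map_add]
    rfl
  smul_mem' := by
    rintro c x ⟨hx, ex⟩
    refine ⟨D.domain.smul_mem c hx, ?_⟩
    rw [smul_comm, ← ex, ← D.map_smul]
    rfl

/-- The spectral subspace `Γ_U`, the sum of the eigenspaces `Γ_l` over the `l` in `U` that lie
in the spectrum.  (The sum is direct when `D` is any linear operator, since eigenspaces of
different eigenvalues are independent.) -/
def spectralSubspace (D : E →ₗ.[ℂ] E) (U : Set ℝ) : Submodule ℂ E :=
  ⨆ l ∈ {l : ℝ | l ∈ U ∧ (l : ℂ) ∈ spec D}, eigenspace D l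

/-- Continuity of a family of self-adjoint operators in the norm-resolvent sense (equivalently,
in the gap topology): the resolvents `(D u - i)⁻¹` depend continuously on `u` in operator norm. -/
def NormResolventContinuous {T : Type*} [TopologicalSpace T] (D : T → E →ₗ.[ℂ] E) : Prop :=
  ∃ R : T → E →L[ℂ] E, (∀ u, IsResolventAt (D u) Complex.I (R u)) ∧ Continuous R

end Operators

section Representations

variable {E : Type*} [NormedAddCommGroup E] [InnerProductSpace ℂ E]
  {H : Type*} [Group H]

/-- A strongly continuous unitary representation. -/
structure IsUnitaryRep [TopologicalSpace H] (ρ : Representation ℂ H E) : Prop where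
  norm_map : ∀ h x, ‖ρ h x‖ = ‖x‖
  continuous_orbit : ∀ x, Continuous fun h => ρ h x

/-- The operator `D` is compatible with the action: each `ρ h` preserves the domain of `D` and
commutes with `D` there. -/
def IsCompatible (ρ : Representation ℂ H E) (D : E →ₗ.[ℂ] E) : Prop :=
  ∀ (h : H) (x : D.domain), ∃ hx : ρ h (x : E) ∈ D.domain, D ⟨ρ h (x : E), hx⟩ = ρ h (D x)

variable {ρ : Representation ℂ H E} {D : E →ₗ.[ℂ] E}

theorem IsCompatible.map_eigenspace (hD : IsCompatible ρ D) (l : ℝ) (h : H) {x : E}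
    (hx : x ∈ eigenspace D l) : ρ h x ∈ eigenspace D l := by
  obtain ⟨hd, e⟩ := hx
  obtain ⟨hd', e'⟩ := hD h ⟨x, hd⟩
  exact ⟨hd', by rw [e', e, map_smul]⟩

/-- The eigenspace `Γ_l` as a subrepresentation. -/
def eigenRep (hD : IsCompatible ρ D) (l : ℝ) : Subrepresentation ρ where
  toSubmodule := eigenspace D l
  apply_mem_toSubmodule h _ hx := hD.map_eigenspace l h hx

/-- The spectral subspace `Γ_U` as a subrepresentation. -/
def spectralRep (hD : IsCompatible ρ D) (U : Set ℝ) : Subrepresentation ρ where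
  toSubmodule := spectralSubspace D U
  apply_mem_toSubmodule h x hx := by
    have key : spectralSubspace D U ≤ (spectralSubspace D U).comap (ρ h) :=
      iSup₂_le fun l hl y hy =>
        (le_iSup₂_of_le (f := fun l (_ : l ∈ {l : ℝ | l ∈ U ∧ (l : ℂ) ∈ spec D}) =>
          eigenspace D l) l hl le_rfl) (hD.map_eigenspace l h hy)
    exact key hx

end Representations

end EquivariantSpectrum

/-! Everything is moved to the bounded normal operators `R u` = (D_u - i)⁻¹, whose (t -
i)⁻¹-eigenspace is Γ_{u,t} (`mem_eigenspace_iff`). The point z = (l - i)⁻¹ is isolated in the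
spectrum of `R u₀`. Take a continuous plateau F around z and P_u = F(R u), which is norm continuous
in u. For u near u₀, upper hemicontinuity keeps the spectrum of `R u` out of the annulus where F
passes from 1 to 0, so P_u is idempotent. Once ‖P_u - P_{u₀}‖ < 1, P_{u₀} maps ran P_u
isomorphically onto ran P_{u₀} = Γ_{u₀,l} (`exists_linearEquiv_of_norm_sub_lt_one`), equivariantly
since it commutes with ρ (`cfc_resolvent_apply`). Being finite-dimensional and `R u`-invariant, ran
P_u is spanned by eigenvectors of D_u, hence equals Γ_{u,U} (`mem_spectralSubspace_iff`). -/

namespace EquivariantSpectrum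

/-! ### Close idempotents -/

section Idempotents

/-- An idempotent at distance less than one from another is injective on its range. -/
theorem eq_zero_of_norm_sub_lt_one {E : Type*} [NormedAddCommGroup E] [NormedSpace ℂ E]
    {P Q : E →L[ℂ] E} (h : ‖P - Q‖ < 1) {x : E} (hP : P x = x) (hQ : Q x = 0) : x = 0 := by
  by_contra hx
  have h1 : ‖(P - Q) x‖ ≤ ‖P - Q‖ * ‖x‖ := (P - Q).le_opNorm x
  have h2 : (P - Q) x = x := by simp [hP, hQ]
  have h3 : 0 < ‖x‖ := norm_pos_iff.mpr hx
  rw [h2] at h1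
  nlinarith

/-- Two close idempotents, one of which has finite-dimensional range, have isomorphic ranges,
the isomorphism being the restriction of either of them. -/
theorem exists_linearEquiv_of_norm_sub_lt_one {E : Type*} [NormedAddCommGroup E] [NormedSpace ℂ E]
    {P Q : E →L[ℂ] E} (hPP : ∀ x, P (P x) = P x) (hQQ : ∀ x, Q (Q x) = Q x) (h : ‖P - Q‖ < 1)
    {V W : Submodule ℂ E} (hV : ∀ x, x ∈ V ↔ P x = x) (hW : ∀ x, x ∈ W ↔ Q x = x)
    [FiniteDimensional ℂ W] :
    ∃ e : V ≃ₗ[ℂ] W, ∀ x, (e x : E) = Q x := by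
  let f : V →ₗ[ℂ] W := ((Q : E →ₗ[ℂ] E).domRestrict V).codRestrict W fun x => (hW _).2 (hQQ x)
  let g : W →ₗ[ℂ] V := ((P : E →ₗ[ℂ] E).domRestrict W).codRestrict V fun x => (hV _).2 (hPP x)
  have hf : Function.Injective f := by
    rw [← LinearMap.ker_eq_bot, LinearMap.ker_eq_bot']
    intro x hx
    exact Subtype.ext (eq_zero_of_norm_sub_lt_one h ((hV x).1 x.2) (congrArg Subtype.val hx))
  have hg : Function.Injective g := by
    rw [← LinearMap.ker_eq_bot, LinearMap.ker_eq_bot']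
    intro x hx
    rw [norm_sub_rev] at h
    exact Subtype.ext (eq_zero_of_norm_sub_lt_one h ((hW x).1 x.2) (congrArg Subtype.val hx))
  -- Only `W` is assumed finite-dimensional; injectivity of `f` transfers this to `V`.
  have : FiniteDimensional ℂ V := Module.Finite.of_injective f hf
  have hfr : Module.finrank ℂ V = Module.finrank ℂ W :=
    le_antisymm (LinearMap.finrank_le_finrank_of_injective hf)
      (LinearMap.finrank_le_finrank_of_injective hg)
  exact ⟨LinearEquiv.ofBijective f
    ⟨hf, (LinearMap.injective_iff_surjective_of_finrank_eq_finrank hfr).1 hf⟩, fun x => rfl⟩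

end Idempotents

/-! ### Functional calculus on eigenvectors -/

section NormalOperators

variable {E : Type*} [NormedAddCommGroup E] [InnerProductSpace ℂ E]

theorem mem_spectrum_of_eigenvector {R : E →L[ℂ] E} {z : ℂ} {x : E} (hx : x ≠ 0)
    (h : R x = z • x) : z ∈ spectrum ℂ R := by
  intro hu
  obtain ⟨S, hS⟩ := hu.exists_left_inv
  apply hx
  have := congrArg (fun T : E →L[ℂ] E => T x) hS
  simpa [h, Algebra.algebraMap_eq_smul_one] using this.symm

variable [CompleteSpace E]

/-- R - z is normal, so it has the same kernel as its adjoint. -/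
theorem star_apply_eigenvector {R : E →L[ℂ] E} (hR : IsStarNormal R) {z : ℂ} {x : E}
    (h : R x = z • x) : (star R) x = star z • x := by
  have hn : IsStarNormal (R - algebraMap ℂ (E →L[ℂ] E) z) := by
    constructor
    have h1 : Commute (star R) R := hR.star_comm_self
    rw [star_sub, ← algebraMap_star_comm]
    exact (h1.sub_right (Algebra.commute_algebraMap_right _ _)).sub_left
      (Algebra.commute_algebraMap_left _ _)
  have h0 : (R - algebraMap ℂ (E →L[ℂ] E) z) x = 0 := by
    simp [h, Algebra.algebraMap_eq_smul_one]
  have h2 := (ContinuousLinearMap.IsStarNormal.adjoint_apply_eq_zero_iff hn x).2 h0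
  rw [← ContinuousLinearMap.star_eq_adjoint, star_sub, ← algebraMap_star_comm] at h2
  simpa [Algebra.algebraMap_eq_smul_one, sub_eq_zero] using h2

/-- The continuous functional calculus acts on eigenvectors by evaluation. -/
theorem cfc_apply_eigenvector {R : E →L[ℂ] E} (hR : IsStarNormal R) {z : ℂ} {x : E} (hx : x ≠ 0)
    (h : R x = z • x) {f : ℂ → ℂ} (hf : Continuous f) : cfc f R x = f z • x := by
  have hz := mem_spectrum_of_eigenvector hx h
  have key : ∀ g : C(spectrum ℂ R, ℂ), cfcHom hR g x = g ⟨z, hz⟩ • x := by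
    intro g
    -- Stone–Weierstrass: the identity holds for polynomials in w and its conjugate, and it is a
    -- closed condition on g.
    induction g using ContinuousMap.induction_on_of_compact with
    | const r =>
      have : cfcHom hR (ContinuousMap.const (spectrum ℂ R) r) = algebraMap ℂ (E →L[ℂ] E) r :=
        AlgHomClass.commutes (cfcHom hR) r
      rw [this]
      simp [Algebra.algebraMap_eq_smul_one]
    | id => rw [cfcHom_id]; exact h
    | star_id => rw [map_star, cfcHom_id]; exact star_apply_eigenvector hR h
    | add f g hf hg => rw [map_add, add_apply, hf, hg,
        ContinuousMap.add_apply, add_smul]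
    | mul f g hf hg => rw [map_mul, mul_apply_eq_comp, hg, map_smul, hf,
        ContinuousMap.mul_apply, smul_smul, mul_comm]
    | frequently f hf =>
      have hc : IsClosed {g : C(spectrum ℂ R, ℂ) | cfcHom hR g x = g ⟨z, hz⟩ • x} := by
        have h1 := cfcHom_continuous (R := ℂ) hR
        exact isClosed_eq (h1.clm_apply continuous_const)
          ((continuous_eval_const _).smul continuous_const)
      exact hc.mem_of_frequently_of_tendsto hf Filter.tendsto_id
  rw [cfc_apply f R hR hf.continuousOn, key]
  rfl

end NormalOperators

/-! ### Resolvents of self-adjoint operators -/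

section Resolvent

variable {E : Type*} [NormedAddCommGroup E] [InnerProductSpace ℂ E]
  {D : E →ₗ.[ℂ] E} {R : E →L[ℂ] E}

theorem _root_.LinearPMap.apply_congr {x y : E} (h : x = y) (hx : x ∈ D.domain)
    (hy : y ∈ D.domain) : D ⟨x, hx⟩ = D ⟨y, hy⟩ := by
  subst h; rfl

theorem IsResolventAt.apply_resolvent {z : ℂ} (h : IsResolventAt D z R) (y : E)
    (hy : R y ∈ D.domain) : D ⟨R y, hy⟩ = y + z • R y :=
  sub_eq_iff_eq_add.1 (h.right_inv y)

theorem IsResolventAt.eq_resolvent {z : ℂ} (h : IsResolventAt D z R) {x y : E}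
    (hx : x ∈ D.domain) (e : D ⟨x, hx⟩ = y + z • x) : x = R y := by
  have := h.left_inv ⟨x, hx⟩
  rw [e] at this
  simpa using this.symm

theorem IsResolventAt.eq_of_apply_eq_zero {z : ℂ} (h : IsResolventAt D z R) {y : E}
    (hy : R y = 0) : y = 0 := by
  have h1 := h.apply_resolvent y (h.mem_domain y)
  rw [LinearPMap.apply_congr hy _ D.domain.zero_mem, hy, smul_zero, add_zero] at h1
  rw [← h1]
  exact D.map_zero

/-- A point of the spectrum of `(D - w)⁻¹` other than zero comes from one of the spectrum of `D`. -/
theorem IsResolventAt.add_inv_mem_spec {w z : ℂ} (h : IsResolventAt D w R) (hz : z ≠ 0)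
    (hs : z ∈ spectrum ℂ R) : w + z⁻¹ ∈ spec D := by
  rintro ⟨S, hS⟩
  apply hs
  -- `e1` and `e2` are the two orders of the resolvent identity.
  have e1 : ∀ y, R y = S y - z⁻¹ • R (S y) := by
    intro y
    have := h.eq_resolvent (x := S y) (y := y + z⁻¹ • S y) (hS.mem_domain y) (by
      rw [hS.apply_resolvent, add_smul]; abel)
    rw [map_add, map_smul] at this
    exact eq_sub_of_add_eq this.symm
  have e2 : ∀ y, S (R y) = z • (S y - R y) := by
    intro y
    have := hS.eq_resolvent (x := R y) (y := y - z⁻¹ • R y) (h.mem_domain y) (by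
      rw [h.apply_resolvent, add_smul]; abel)
    rw [map_sub, map_smul] at this
    have h2 : z⁻¹ • S (R y) = S y - R y := by
      nth_rewrite 2 [this]; abel
    rw [← h2, smul_inv_smul₀ hz]
  -- Formally z - R = z(D - w - z⁻¹)(D - w)⁻¹, with inverse z⁻¹(D - w)S = z⁻¹(1 + z⁻¹S).
  refine ⟨⟨algebraMap ℂ _ z - R, z⁻¹ • (1 + z⁻¹ • S), ?_, ?_⟩, rfl⟩
  · ext y
    simp only [Algebra.algebraMap_eq_smul_one, mul_apply_eq_comp, sub_apply, smul_apply,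
      add_apply, one_apply_eq_self, map_add, map_smul, smul_add]
    rw [e1 y]
    match_scalars <;> field_simp <;> ring
  · ext y
    simp only [Algebra.algebraMap_eq_smul_one, mul_apply_eq_comp, sub_apply, smul_apply,
      add_apply, one_apply_eq_self, map_sub, map_smul]
    rw [e2 y]
    match_scalars <;> field_simp <;> ring

theorem real_sub_I_ne_zero (l : ℝ) : (l : ℂ) - Complex.I ≠ 0 := by
  intro h
  have := congrArg Complex.im h
  simp at this

/-- Eigenvectors of `D` are eigenvectors of its resolvent at `i`. -/
theorem IsResolventAt.mem_eigenspace_iff (h : IsResolventAt D Complex.I R) (l : ℝ) (x : E) :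
    x ∈ eigenspace D l ↔ R x = ((l : ℂ) - Complex.I)⁻¹ • x := by
  have hl := real_sub_I_ne_zero l
  constructor
  · rintro ⟨hx, e⟩
    have := h.eq_resolvent (y := ((l : ℂ) - Complex.I) • x) hx (by rw [e]; module)
    nth_rewrite 2 [this]
    rw [map_smul, smul_smul, inv_mul_cancel₀ hl, one_smul]
  · intro e
    have e' : R (((l : ℂ) - Complex.I) • x) = x := by
      rw [map_smul, e, smul_smul, mul_inv_cancel₀ hl, one_smul]
    have hx : x ∈ D.domain := e' ▸ h.mem_domain _
    refine ⟨hx, ?_⟩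
    rw [LinearPMap.apply_congr e'.symm hx (h.mem_domain _), h.apply_resolvent, e']
    module

theorem mem_spec_of_eigenvector {l : ℝ} {x : E} (hx : x ≠ 0) (h : x ∈ eigenspace D l) :
    (l : ℂ) ∈ spec D := by
  rintro ⟨S, hS⟩
  obtain ⟨hd, e⟩ := h
  have := hS.left_inv ⟨x, hd⟩
  rw [e] at this
  exact hx (by simpa using this.symm)

variable [CompleteSpace E]

theorem inner_apply_of_isSelfAdjoint (hD : IsSelfAdjoint D) (x y : D.domain) :
    inner ℂ (D x) (y : E) = inner ℂ (x : E) (D y) := by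
  have h := LinearPMap.adjoint_isFormalAdjoint hD.dense_domain
  rw [LinearPMap.isSelfAdjoint_def.1 hD] at h
  exact h x y

open ContinuousLinearMap in
/-- The adjoint of the resolvent at `i` is the resolvent at `-i`. -/
theorem IsResolventAt.isResolventAt_adjoint (hD : IsSelfAdjoint D) (h : IsResolventAt D Complex.I R) :
    IsResolventAt D (-Complex.I) (adjoint R) := by
  have hin : ∀ (y : E) (x : D.domain),
      inner ℂ (y - Complex.I • adjoint R y) (x : E) = inner ℂ (adjoint R y) (D x) := by
    intro y x
    have h1 : inner ℂ (adjoint R y) (D x - Complex.I • (x : E)) = inner ℂ y (x : E) := by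
      rw [adjoint_inner_left, h.left_inv]
    rw [inner_sub_right, inner_smul_right] at h1
    rw [inner_sub_left, inner_smul_left, ← h1, Complex.conj_I]
    ring
  have hmem : ∀ y, adjoint R y ∈ D.domain := by
    intro y
    have := LinearPMap.mem_adjoint_domain_of_exists (T := D) (adjoint R y) ⟨_, hin y⟩
    rwa [LinearPMap.isSelfAdjoint_def.1 hD] at this
  refine ⟨hmem, fun y => ?_, fun x => ?_⟩
  · have h2 : D ⟨adjoint R y, hmem y⟩ = y - Complex.I • adjoint R y := by
      refine hD.dense_domain.eq_of_inner_left ℂ fun v hv => ?_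
      rw [hin y ⟨v, hv⟩]
      exact inner_apply_of_isSelfAdjoint hD ⟨_, hmem y⟩ ⟨v, hv⟩
    rw [h2]; module
  · refine ext_inner_right ℂ fun y => ?_
    rw [adjoint_inner_left, inner_sub_left,
      inner_apply_of_isSelfAdjoint hD x ⟨R y, h.mem_domain y⟩, h.apply_resolvent, inner_add_right,
      inner_smul_right, inner_smul_left]
    simp

-- By the resolvent identity at i and -i, both R*R and RR* equal (R - R*)/2i.
open ContinuousLinearMap in
theorem IsResolventAt.isStarNormal (hD : IsSelfAdjoint D) (h : IsResolventAt D Complex.I R) :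
    IsStarNormal R := by
  have h' := h.isResolventAt_adjoint hD
  refine ⟨?_⟩
  rw [commute_iff_eq, star_eq_adjoint]
  ext y
  simp only [mul_apply_eq_comp]
  have e1 := h.eq_resolvent (x := adjoint R y) (y := y - (2 * Complex.I) • adjoint R y)
    (h'.mem_domain y) (by rw [h'.apply_resolvent]; module)
  have e2 := h'.eq_resolvent (x := R y) (y := y + (2 * Complex.I) • R y)
    (h.mem_domain y) (by rw [h.apply_resolvent]; module)
  rw [map_sub, map_smul] at e1
  rw [map_add, map_smul] at e2
  have h2 : (2 * Complex.I) ≠ 0 := by simp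
  apply smul_right_injective E h2
  have e3 : (2 * Complex.I) • (adjoint R) (R y) = R y - adjoint R y :=
    eq_sub_of_add_eq' e2.symm
  have e4 : (2 * Complex.I) • R (adjoint R y) = R y - adjoint R y :=
    eq_sub_of_add_eq' (eq_sub_iff_add_eq.1 e1)
  exact e3.trans e4.symm

end Resolvent

/-! ### Equivariance of functions of the resolvent -/

section Equivariance

variable {E : Type*} [NormedAddCommGroup E] [InnerProductSpace ℂ E]
  {H : Type*} [Group H] {ρ : Representation ℂ H E} {D : E →ₗ.[ℂ] E} {R : E →L[ℂ] E}

theorem IsCompatible.resolvent_apply (hD : IsCompatible ρ D) {z : ℂ} (h : IsResolventAt D z R)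
    (g : H) (y : E) : R (ρ g y) = ρ g (R y) := by
  obtain ⟨hx, e⟩ := hD g ⟨R y, h.mem_domain y⟩
  exact (h.eq_resolvent hx (by rw [e, h.apply_resolvent, map_add, map_smul])).symm

/-- Both R and R* are resolvents of D, so ρ(g) commutes with both, and hence with every F(R). -/
theorem IsCompatible.cfc_resolvent_apply [CompleteSpace E] [TopologicalSpace H] (hρ : IsUnitaryRep ρ)
    (hD : IsCompatible ρ D) (hsa : IsSelfAdjoint D)
    (h : IsResolventAt D Complex.I R) (f : ℂ → ℂ) (g : H) (y : E) :
    cfc f R (ρ g y) = ρ g (cfc f R y) := by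
  let T : E →L[ℂ] E := (ρ g).mkContinuous 1 fun x => by rw [hρ.norm_map, one_mul]
  have h1 : Commute R T := by ext y; exact hD.resolvent_apply h g y
  have h2 : Commute (star R) T := by ext y; exact hD.resolvent_apply (h.isResolventAt_adjoint hsa) g y
  exact congrArg (fun S : E →L[ℂ] E => S y) (h1.cfc h2 f)

end Equivariance

/-! ### Spectral subspaces as ranges of projections -/

section SpectralSubspace

variable {E : Type*} [NormedAddCommGroup E] [InnerProductSpace ℂ E] [CompleteSpace E]
  {D : E →ₗ.[ℂ] E} {R : E →L[ℂ] E}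

/-- A finite-dimensional subspace invariant under the resolvent is spanned by eigenvectors. -/
theorem IsResolventAt.le_iSup_inf_eigenspace (hsa : IsSelfAdjoint D)
    (h : IsResolventAt D Complex.I R) {W : Submodule ℂ E} [FiniteDimensional ℂ W]
    (hW : ∀ x ∈ W, R x ∈ W) : W ≤ ⨆ l : ℝ, W ⊓ eigenspace D l := by
  -- R is injective, hence bijective on `W`. So `W` lies in dom D and is D-invariant, and the
  -- finite-dimensional spectral theorem applies to D on `W`.
  have hinj : Function.Injective ((R : E →ₗ[ℂ] E).restrict hW) := by
    rw [← LinearMap.ker_eq_bot, LinearMap.ker_eq_bot']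
    intro x hx
    exact Subtype.ext (h.eq_of_apply_eq_zero (congrArg Subtype.val hx))
  have hsurj : ∀ x ∈ W, ∃ y ∈ W, R y = x := by
    intro x hx
    obtain ⟨y, hy⟩ := LinearMap.injective_iff_surjective.1 hinj ⟨x, hx⟩
    exact ⟨y, y.2, congrArg Subtype.val hy⟩
  have hdom : W ≤ D.domain := by
    intro x hx
    obtain ⟨y, -, rfl⟩ := hsurj x hx
    exact h.mem_domain y
  have hDW : ∀ (x : E) (hx : x ∈ W), D ⟨x, hdom hx⟩ ∈ W := by
    intro x hx
    obtain ⟨y, hy, rfl⟩ := hsurj x hx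
    rw [h.apply_resolvent]
    exact W.add_mem hy (W.smul_mem _ hx)
  let T : W →ₗ[ℂ] W := (D.toFun ∘ₗ Submodule.inclusion hdom).codRestrict W fun x => hDW x x.2
  have hT : ∀ x : W, (T x : E) = D ⟨x, hdom x.2⟩ := fun x => rfl
  have hTs : T.IsSymmetric := fun x y =>
    inner_apply_of_isSelfAdjoint hsa ⟨x, hdom x.2⟩ ⟨y, hdom y.2⟩
  have htop : (⨆ μ, Module.End.eigenspace T μ) = ⊤ :=
    Submodule.orthogonal_eq_bot_iff.1 hTs.orthogonalComplement_iSup_eigenspaces_eq_bot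
  have hmap : W = (⨆ μ, Module.End.eigenspace T μ).map W.subtype := by
    rw [htop, Submodule.map_subtype_top]
  refine hmap.le.trans ?_
  rw [Submodule.map_iSup]
  refine iSup_le fun μ => ?_
  rintro _ ⟨x, hx, rfl⟩
  by_cases hx0 : x = 0
  · simp [hx0]
  have hμ : (μ.re : ℂ) = μ := Complex.conj_eq_iff_re.1 (hTs.conj_eigenvalue_eq_self
    (Module.End.hasEigenvalue_of_hasEigenvector ⟨hx, hx0⟩))
  refine Submodule.mem_iSup_of_mem μ.re ⟨x.2, hdom x.2, ?_⟩
  rw [hμ]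
  exact congrArg Subtype.val (Module.End.mem_eigenspace_iff.1 hx)

/-- The spectral subspace of an open set is the range of the corresponding spectral projection. -/
theorem IsResolventAt.mem_spectralSubspace_iff (hsa : IsSelfAdjoint D)
    (h : IsResolventAt D Complex.I R) {F : ℂ → ℂ} (hF : Continuous F) {U : Set ℝ}
    (h1 : ∀ l : ℝ, l ∈ U → ((l : ℂ) - Complex.I)⁻¹ ∈ spectrum ℂ R →
      F ((l : ℂ) - Complex.I)⁻¹ = 1)
    (h0 : ∀ l : ℝ, F ((l : ℂ) - Complex.I)⁻¹ = 1 → ((l : ℂ) - Complex.I)⁻¹ ∈ spectrum ℂ R →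
      l ∈ U)
    {W : Submodule ℂ E} (hW : ∀ x, x ∈ W ↔ cfc F R x = x) [FiniteDimensional ℂ W] :
    spectralSubspace D U = W := by
  have hR := h.isStarNormal hsa
  apply le_antisymm
  · refine iSup₂_le fun l hl x hx => (hW x).2 ?_
    by_cases hx0 : x = 0
    · simp [hx0]
    have hx' := (h.mem_eigenspace_iff l x).1 hx
    rw [cfc_apply_eigenvector hR hx0 hx' hF, h1 l hl.1 (mem_spectrum_of_eigenvector hx0 hx'),
      one_smul]
  · have hinv : ∀ x ∈ W, R x ∈ W := by
      intro x hx
      have hc : Commute (cfc F R) R := (Commute.refl R).cfc hR.star_comm_self F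
      have := congrArg (fun S : E →L[ℂ] E => S x) hc.eq
      simp only [mul_apply_eq_comp] at this
      rw [hW, this, (hW x).1 hx]
    refine (h.le_iSup_inf_eigenspace hsa hinv).trans (iSup_le fun l => ?_)
    rintro x ⟨hxW, hx⟩
    by_cases hx0 : x = 0
    · simp [hx0]
    have hx' := (h.mem_eigenspace_iff l x).1 hx
    have hF1 : F ((l : ℂ) - Complex.I)⁻¹ = 1 := by
      have h2 := (hW x).1 hxW
      rw [cfc_apply_eigenvector hR hx0 hx' hF] at h2
      exact smul_left_injective ℂ hx0 (by simpa using h2)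
    have hlU := h0 l hF1 (mem_spectrum_of_eigenvector hx0 hx')
    exact Submodule.mem_iSup_of_mem l (Submodule.mem_iSup_of_mem
      ⟨hlU, mem_spec_of_eigenvector hx0 hx⟩ hx)

end SpectralSubspace

/-! ### Plateau functions and isolation in the resolvent spectrum -/

section Bump

/-- A continuous function equal to one near `z` and to zero away from it. -/
theorem exists_plateau (z : ℂ) {r : ℝ} (hr : 0 < r) :
    ∃ F : ℂ → ℂ, Continuous F ∧ (∀ w, dist w z ≤ r → F w = 1) ∧
      ∀ w, 2 * r ≤ dist w z → F w = 0 := by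
  refine ⟨fun w => ((max 0 (min 1 (2 - dist w z / r)) : ℝ) : ℂ), by fun_prop, fun w hw => ?_,
    fun w hw => ?_⟩
  · have : dist w z / r ≤ 1 := (div_le_one hr).2 hw
    beta_reduce
    rw [min_eq_left (by linarith), max_eq_right zero_le_one, Complex.ofReal_one]
  · have : 2 ≤ dist w z / r := (le_div_iff₀ hr).2 hw
    beta_reduce
    rw [max_eq_left ((min_le_right _ _).trans (by linarith)), Complex.ofReal_zero]

/-- The spectrum of the resolvent of an operator with discrete spectrum is isolated at the point
corresponding to a point of the spectrum. -/
theorem IsResolventAt.exists_ball_inter_spectrum {E : Type*} [NormedAddCommGroup E]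
    [InnerProductSpace ℂ E] {D : E →ₗ.[ℂ] E} {R : E →L[ℂ] E} (h : IsResolventAt D Complex.I R)
    (hd : HasDiscreteSpectrum D) {l : ℝ} (hl : (l : ℂ) ∈ spec D) :
    ∃ r > 0, ∀ w ∈ spectrum ℂ R, dist w ((l : ℂ) - Complex.I)⁻¹ < r →
      w = ((l : ℂ) - Complex.I)⁻¹ := by
  have hz := inv_ne_zero (real_sub_I_ne_zero l)
  set z := ((l : ℂ) - Complex.I)⁻¹ with hzdef
  have hdisc : ∀ᶠ y in 𝓝 (l : ℂ), y ∈ spec D → y = l := by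
    have hd' : IsDiscrete (spec D) := ⟨hd⟩
    obtain ⟨V, hV, hVe⟩ := (isDiscrete_iff_forall_mem_exists_isOpen.1 hd') _ hl
    have hlV : (l : ℂ) ∈ V := (hVe.ge rfl).1
    filter_upwards [hV.mem_nhds hlV] with y hy hys
    exact hVe.le ⟨hy, hys⟩
  have hc : Filter.Tendsto (fun w : ℂ => Complex.I + w⁻¹) (𝓝 z) (𝓝 (l : ℂ)) := by
    have : ContinuousAt (fun w : ℂ => Complex.I + w⁻¹) z :=
      continuousAt_const.add (continuousAt_inv₀ hz)
    have h2 : Complex.I + z⁻¹ = l := by rw [hzdef, inv_inv]; ring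
    simpa only [ContinuousAt, h2] using this
  obtain ⟨r, hr, hball⟩ := Metric.eventually_nhds_iff.1
    ((hc.eventually hdisc).and (eventually_ne_nhds hz))
  refine ⟨r, hr, fun w hw hwr => ?_⟩
  obtain ⟨h1, h2⟩ := hball hwr
  have h3 := h1 (h.add_inv_mem_spec h2 hw)
  rw [hzdef, ← h3, add_sub_cancel_left, inv_inv]

end Bump

end EquivariantSpectrum

/-! ### The main theorem -/

open EquivariantSpectrum in
theorem lemma2p2
    {E : Type*} [NormedAddCommGroup E] [InnerProductSpace ℂ E] [CompleteSpace E]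
    {H : Type*} [Group H] [TopologicalSpace H] [IsTopologicalGroup H] [CompactSpace H]
    (ρ : Representation ℂ H E) (hρ : IsUnitaryRep ρ)
    (D : Set.Icc (0 : ℝ) 1 → E →ₗ.[ℂ] E)
    (hsa : ∀ u, IsSelfAdjoint (D u))
    (hdisc : ∀ u, HasDiscreteSpectrum (D u))
    (hcont : NormResolventContinuous D)
    (hcomp : ∀ u, IsCompatible ρ (D u))
    (u₀ : Set.Icc (0 : ℝ) 1) (l : ℝ) (hl : (l : ℂ) ∈ spec (D u₀))
    (k : ℕ) (hk : Module.rank ℂ (eigenspace (D u₀) l) = k) :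
    ∃ U : Set ℝ, IsOpen U ∧ l ∈ U ∧ ∃ ε : ℝ, 0 < ε ∧
      ∀ u : Set.Icc (0 : ℝ) 1, |(u : ℝ) - (u₀ : ℝ)| < ε →
        Module.rank ℂ (spectralSubspace (D u) U) = k ∧
        Nonempty ((spectralRep (hcomp u) U).toRepresentation.Equiv
          (eigenRep (hcomp u₀) l).toRepresentation) := by
  obtain ⟨R, hR, hRc⟩ := hcont
  have hn : ∀ u, IsStarNormal (R u) := fun u => (hR u).isStarNormal (hsa u)
  obtain ⟨r, hr, hball⟩ := (hR u₀).exists_ball_inter_spectrum (hdisc u₀) hl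
  obtain ⟨F, hF, hF1, hF0⟩ := exists_plateau ((l : ℂ) - Complex.I)⁻¹ (r := r / 4) (by linarith)
  set z := ((l : ℂ) - Complex.I)⁻¹ with hz
  -- The spectrum avoids an annulus around `z` for parameters close to `u₀`.
  have hev1 : ∀ᶠ u in 𝓝 u₀, spectrum ℂ (R u) ⊆ {w | dist w z < r / 4 ∨ r / 2 < dist w z} := by
    have hopen : IsOpen {w : ℂ | dist w z < r / 4 ∨ r / 2 < dist w z} :=
      (isOpen_lt (f := fun w => dist w z) (by fun_prop) continuous_const).union
        (isOpen_lt (g := fun w => dist w z) continuous_const (by fun_prop))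
    refine hRc.continuousAt.eventually (upperHemicontinuousAt_iff_forall_isOpen.1
      (upperHemicontinuous_spectrum ℂ (E →L[ℂ] E) |>.upperHemicontinuousAt (R u₀)) _ hopen ?_)
    intro w hw
    by_cases hwr : dist w z < r
    · left
      rw [hball w hw hwr, dist_self]
      linarith
    · right
      linarith
  -- Continuity of the functional calculus needs one compact set containing all nearby spectra.
  have hPc : ContinuousAt (fun u => cfc F (R u)) u₀ := by
    refine ContinuousAt.cfc (isCompact_closedBall (0 : ℂ) ((‖R u₀‖ + 1) * ‖(1 : E →L[ℂ] E)‖)) F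
      hRc.continuousAt ?_ (.of_forall hn) hF.continuousOn
    have : ∀ᶠ u in 𝓝 u₀, ‖R u‖ < ‖R u₀‖ + 1 :=
      hRc.norm.continuousAt.eventually_lt continuousAt_const (lt_add_one _)
    filter_upwards [this] with u hu w hw
    rw [mem_closedBall_zero_iff]
    exact (spectrum.norm_le_norm_mul_of_mem hw).trans (by gcongr)
  have hev2 : ∀ᶠ u in 𝓝 u₀, ‖cfc F (R u) - cfc F (R u₀)‖ < 1 := by
    have := Metric.tendsto_nhds.1 hPc 1 one_pos
    simpa only [dist_eq_norm] using this
  obtain ⟨ε, hε, hboth⟩ := Metric.eventually_nhds_iff.1 (hev1.and hev2)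
  have hidem : ∀ u, dist u u₀ < ε → ∀ x, cfc F (R u) (cfc F (R u) x) = cfc F (R u) x := by
    intro u hu x
    have h1 : cfc F (R u) * cfc F (R u) = cfc F (R u) := by
      rw [← cfc_mul F F (R u) hF.continuousOn hF.continuousOn]
      refine cfc_congr fun w hw => ?_
      rcases (hboth hu).1 hw with h | h
      · simp [hF1 w h.le]
      · simp [hF0 w (by linarith)]
    exact congrArg (fun S : E →L[ℂ] E => S x) h1
  have hW0 : ∀ x, x ∈ eigenspace (D u₀) l ↔ cfc F (R u₀) x = x := by
    intro x
    rw [(hR u₀).mem_eigenspace_iff, ← hz]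
    constructor
    · intro hx
      by_cases hx0 : x = 0
      · simp [hx0]
      rw [cfc_apply_eigenvector (hn u₀) hx0 hx hF, hF1 z (by rw [dist_self]; linarith), one_smul]
    · intro hx
      -- On the spectrum of `R u₀`, either w = z or F(w) = 0, so wF(w) = zF(w).
      have h1 : R u₀ * cfc F (R u₀) = z • cfc F (R u₀) := by
        nth_rewrite 1 [← cfc_id' ℂ (R u₀) (hn u₀)]
        rw [← cfc_mul (fun w => w) F (R u₀) continuousOn_id hF.continuousOn,
          ← cfc_smul z F (R u₀) hF.continuousOn]
        refine cfc_congr fun w hw => ?_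
        by_cases hwr : dist w z < r
        · simp [hball w hw hwr]
        · simp [hF0 w (by linarith)]
      have h2 := congrArg (fun S : E →L[ℂ] E => S x) h1
      simpa [hx] using h2
  have hfin : FiniteDimensional ℂ (eigenspace (D u₀) l) :=
    Module.rank_lt_aleph0_iff.1 (hk ▸ Cardinal.natCast_lt_aleph0)
  -- Any radius between r/4 and r/2 works: the nearby spectra avoid that annulus, so on them
  -- membership in `U` is equivalent to F = 1.
  let U : Set ℝ := {t | dist ((t : ℂ) - Complex.I)⁻¹ z < r / 3}
  have hUo : IsOpen U := by
    refine isOpen_lt (Continuous.dist ?_ continuous_const) continuous_const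
    exact Continuous.inv₀ (by fun_prop) real_sub_I_ne_zero
  refine ⟨U, hUo, ?_, ε, hε, fun u hu => ?_⟩
  · change dist ((l : ℂ) - Complex.I)⁻¹ z < r / 3
    rw [← hz, dist_self]
    linarith
  obtain ⟨hsp, hnorm⟩ := hboth (y := u) hu
  let W : Submodule ℂ E := LinearMap.eqLocus (cfc F (R u)).toLinearMap LinearMap.id
  have hW : ∀ x, x ∈ W ↔ cfc F (R u) x = x := fun x => Iff.rfl
  have hidem₀ := hidem u₀ (by rwa [dist_self])
  -- This first isomorphism only serves to make `W` finite-dimensional, as needed to identify it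
  -- with the spectral subspace.
  obtain ⟨e₀, -⟩ := exists_linearEquiv_of_norm_sub_lt_one (hidem u hu) hidem₀ hnorm hW hW0
  have : FiniteDimensional ℂ W := Module.Finite.equiv e₀.symm
  have hWU : spectralSubspace (D u) U = W := by
    refine (hR u).mem_spectralSubspace_iff (hsa u) hF (fun t ht hs => ?_) (fun t ht hs => ?_) hW
    · rcases hsp hs with h | h
      · exact hF1 _ h.le
      · have : dist ((t : ℂ) - Complex.I)⁻¹ z < r / 3 := ht
        linarith
    · rcases hsp hs with h | h
      · change dist ((t : ℂ) - Complex.I)⁻¹ z < r / 3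
        linarith
      · rw [hF0 _ (by linarith)] at ht
        exact absurd ht zero_ne_one
  have hV : ∀ x, x ∈ spectralSubspace (D u) U ↔ cfc F (R u) x = x := fun x => by rw [hWU, hW]
  obtain ⟨e, he⟩ := exists_linearEquiv_of_norm_sub_lt_one (hidem u hu) hidem₀ hnorm hV hW0
  refine ⟨e.rank_eq.trans hk, ⟨Representation.Equiv.mk
    (ρ := (spectralRep (hcomp u) U).toRepresentation)
    (σ := (eigenRep (hcomp u₀) l).toRepresentation) e fun g => ?_⟩⟩
  ext x
  change (e _ : E) = ρ g (e x : E)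
  exact (he _).trans (((hcomp u₀).cfc_resolvent_apply hρ (hsa u₀) (hR u₀) F g x).trans
    (congrArg (ρ g) (he x).symm))
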